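/- Let $R$ be an integral domain with quotient field $K$. For a nonzero fractional ideal $I$ of a domain $D$ with quotient field $K$ put $I^{-1}=(D:_K I)=\{x\in K : xI\subseteq D\}$, $I_v=(I^{-1})^{-1}$, and $I_t=\bigcup J_v$, the union over all nonzero finitely generated subideals $J\subseteq I$. A *$t$-ideal* of $D$ is a nonzero ideal $I\subseteq D$ with $I=I_t$; a *maximal $t$-ideal* is a maximal element of the set of proper $t$-ideals of $D$ (it is automatically prime), and $t\text{-Max}(D)$ is the set of these. * $D$ is a *Prüfer $v$-multiplication domain* (PVMD) if $D_M$ is a valuation domain for every $M\in t\text{-Max}(D)$. * $D$ is a *$t\#$-domain* if $\bigcap_{M\in\mathcal M_1}D_M\neq\bigcap_{M\in\mathcal M_2}D_M$ for any two distinct subsets $\mathcal M_1,\mathcal M_2$ of $t\text{-Max}(D)$ (an empty intersection being $K$). * For a set $\Lambda$ of prime $t$-ideals of $R$ let $\Phi(\Lambda)$ be the set of $t$-ideals $I$ of $R$ with $I\nsubseteq P$ for all $P\in\Lambda$, and let $R_{\Phi(\Lambda)}=\{x\in K : xI\subseteq R\text{ for some }I\in\Phi(\Lambda)\}$. $R$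 is a *$t\#_P$-domain* if $R_{\Phi(\Lambda_1)}\neq R_{\Phi(\Lambda_2)}$ whenever $\Lambda_1\neq\Lambda_2$ are two sets of prime $t$-ideals of $R$ such that $(P+Q)_t=R$ for every pair of distinct ideals $P\in\Lambda_1$, $Q\in\Lambda_2$. * An overring $T$ of $R$ (a ring with $R\subseteq T\subseteq K$) is *$t$-linked* over $R$ if for every finitely generated ideal $I$ of $R$ with $(R:_K I)=R$ one has $(T:_K IT)=T$. Suppose $R$ is a PVMD. Then $R$ is a $t\#_P$-domain if and only if every $t$-linked overring of $R$ is a $t\#$-domain. -/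

import Mathlib

open scoped nonZeroDivisors

namespace TSharp

/-! Throughout, `R` is an integral domain and `K` is its quotient field. -/

/-- `I_v = (I⁻¹)⁻¹` for a nonzero fractional ideal `I`, where `I⁻¹ = (R :_K I)`. -/
noncomputable def vClosure {R K : Type*} [CommRing R] [IsDomain R] [Field K] [Algebra R K]
    [IsFractionRing R K] (I : FractionalIdeal R⁰ K) : FractionalIdeal R⁰ K :=
  (I⁻¹)⁻¹

/-- `I_t`, the union of the `J_v` over all nonzero finitely generated subideals `J` of the
nonzero fractional ideal `I`, as a subset of `K`. -/
def tClosure {R K : Type*} [CommRing R] [IsDomain R] [Field K] [Algebra R K]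
    [IsFractionRing R K] (I : FractionalIdeal R⁰ K) : Set K :=
  {x | ∃ J : FractionalIdeal R⁰ K,
    J ≠ 0 ∧ (J : Submodule R K).FG ∧ J ≤ I ∧ x ∈ vClosure J}

/-- An integral `t`-ideal of `R`: a nonzero ideal `I` of `R` with `I_t = I`. -/
def IsTIdeal {R : Type*} (K : Type*) [CommRing R] [IsDomain R] [Field K] [Algebra R K]
    [IsFractionRing R K] (I : Ideal R) : Prop :=
  I ≠ ⊥ ∧ tClosure (I : FractionalIdeal R⁰ K) = {x : K | x ∈ (I : FractionalIdeal R⁰ K)}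

/-- A prime `t`-ideal of `R`. -/
def IsTPrime {R : Type*} (K : Type*) [CommRing R] [IsDomain R] [Field K] [Algebra R K]
    [IsFractionRing R K] (P : Ideal R) : Prop :=
  P.IsPrime ∧ IsTIdeal K P

/-- `t-Max(R)`: the maximal elements of the set of proper `t`-ideals of `R`. -/
def tMax (R K : Type*) [CommRing R] [IsDomain R] [Field K] [Algebra R K]
    [IsFractionRing R K] : Set (Ideal R) :=
  {M | Maximal (fun I : Ideal R => IsTIdeal K I ∧ I ≠ ⊤) M}

/-- For a prime ideal `P` of `R`, the localization `R_P` as a subset of `K`: the fractions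
`a / s` with `a, s ∈ R`, `s ∉ P`. (It is used for prime `t`-ideals and for maximal `t`-ideals;
the latter are always prime.) -/
def localizationAt {R : Type*} (K : Type*) [CommRing R] [Field K] [Algebra R K]
    (P : Ideal R) : Set K :=
  {x | ∃ a s : R, s ∉ P ∧ x = algebraMap R K a / algebraMap R K s}

/-- `R` is a Prüfer `v`-multiplication domain: `R_M` is a valuation domain (a valuation ring
of `K`) for every maximal `t`-ideal `M` of `R`. -/
def IsPVMD (R K : Type*) [CommRing R] [IsDomain R] [Field K] [Algebra R K]
    [IsFractionRing R K] : Prop :=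
  ∀ M ∈ tMax R K, ∃ V : ValuationSubring K, (V : Set K) = localizationAt K M

/-- `R` is a `t#`-domain: distinct subsets of `t-Max(R)` give distinct intersections of
localizations inside `K` (the empty intersection is `K`). -/
def IsTSharp (R K : Type*) [CommRing R] [IsDomain R] [Field K] [Algebra R K]
    [IsFractionRing R K] : Prop :=
  ∀ M₁ M₂ : Set (Ideal R), M₁ ⊆ tMax R K → M₂ ⊆ tMax R K → M₁ ≠ M₂ →
    (⋂ M ∈ M₁, localizationAt K M) ≠ ⋂ M ∈ M₂, localizationAt K M

/-- `Φ(Λ)`: the `t`-ideals of `R` that are contained in no member of `Λ`. -/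
def tLocSystem {R : Type*} (K : Type*) [CommRing R] [IsDomain R] [Field K] [Algebra R K]
    [IsFractionRing R K] (Λ : Set (Ideal R)) : Set (Ideal R) :=
  {I | IsTIdeal K I ∧ ∀ P ∈ Λ, ¬ I ≤ P}

/-- The generalized ring of quotients `R_Φ = {x ∈ K | x I ⊆ R for some I ∈ Φ}`, as a subset
of `K`. -/
def genQuotients {R : Type*} (K : Type*) [CommRing R] [Field K] [Algebra R K]
    (Φ : Set (Ideal R)) : Set K :=
  {x | ∃ I ∈ Φ, ∀ a ∈ I, ∃ r : R, x * algebraMap R K a = algebraMap R K r}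

/-- `R` is a `t#_P`-domain: if `Λ₁ ≠ Λ₂` are sets of prime `t`-ideals with `(P + Q)_t = R` for
all distinct `P ∈ Λ₁` and `Q ∈ Λ₂`, then `R_{Φ(Λ₁)} ≠ R_{Φ(Λ₂)}`. -/
def IsTSharpP (R K : Type*) [CommRing R] [IsDomain R] [Field K] [Algebra R K]
    [IsFractionRing R K] : Prop :=
  ∀ Λ₁ Λ₂ : Set (Ideal R), (∀ P ∈ Λ₁, IsTPrime K P) → (∀ Q ∈ Λ₂, IsTPrime K Q) → Λ₁ ≠ Λ₂ →
    (∀ P ∈ Λ₁, ∀ Q ∈ Λ₂, P ≠ Q →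
      tClosure ((P + Q : Ideal R) : FractionalIdeal R⁰ K) = Set.range (algebraMap R K)) →
    genQuotients K (tLocSystem K Λ₁) ≠ genQuotients K (tLocSystem K Λ₂)

/-- `K` is also the quotient field of every overring `T` of `R` (`R ⊆ T ⊆ K`). -/
instance overringIsFractionRing {R K : Type*} [CommRing R] [IsDomain R] [Field K] [Algebra R K]
    [IsFractionRing R K] (T : Subalgebra R K) : IsFractionRing T K := by
  refine IsFractionRing.of_field T K fun z => ?_
  obtain ⟨x, y, hxy⟩ := IsFractionRing.div_surjective (A := R) z
  exact ⟨algebraMap R T x, algebraMap R T y, hxy.2.symm⟩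

/-- The overring `T` of `R` is `t`-linked over `R`: for each finitely generated ideal `I` of `R`
with `(R : I) = R`, one has `(T : I T) = T`. -/
def IsTLinked {R K : Type*} [CommRing R] [IsDomain R] [Field K] [Algebra R K]
    [IsFractionRing R K] (T : Subalgebra R K) : Prop :=
  ∀ I : Ideal R, I.FG → (I : FractionalIdeal R⁰ K)⁻¹ = 1 →
    ((I.map (algebraMap R T) : Ideal T) : FractionalIdeal T⁰ K)⁻¹ = 1

end TSharp

/-!
Both conditions compare intersections of localizations of `R` at prime `t`-ideals.

* The conductor `(R :_R x)` of any `x ∈ K` is a `t`-ideal, so `R_{Φ(Λ)} = ⋂_{P ∈ Λ} R_P`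
  (`genQuotients_tLocSystem`).
* In a PVMD every prime `t`-ideal `P` has a valuation ring as its localization, and conversely a
  nonzero prime with this property is a `t`-ideal (`IsValuationAt.isTIdeal`). Primes below a common
  maximal `t`-ideal are comparable (`IsValuationAt.le_or_le`).
* If `N` is a maximal `t`-ideal of a `t`-linked overring `T`, then `P = N ∩ R` is a prime `t`-ideal
  and `T_N = R_P` (`isTPrime_comap_and_localizationAt`). Conversely, a prime `t`-ideal `P` of `R` with
  `T ⊆ R_P` lies under some maximal `t`-ideal `N` of `T`, with `T_N ⊆ R_P`
  (`exists_tMax_of_subset_localizationAt`).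

If `R` is a `t#_P`-domain, contraction turns two distinct sets of maximal `t`-ideals of `T` into
distinct sets of prime `t`-ideals of `R`. Distinct contractions are incomparable, hence
`t`-comaximal, so the two intersections differ.

If every `t`-linked overring is a `t#`-domain and `⋂_{P ∈ Λ₁} R_P = ⋂_{Q ∈ Λ₂} R_Q`, then this
ring `T` is `t`-linked. For `P ∈ Λ₁` choose a maximal `t`-ideal `N` of `T` over `P`. By the
`t#`-property some `x` lies in every other `T_{N'}` but not in `T_N`; hence `x ∉ T`, so `x ∉ R_Q`
for some `Q ∈ Λ₂`, and a maximal `t`-ideal of `T` over `Q` can only be `N`. Thus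
`P + Q ⊆ N ∩ R`, a proper `t`-ideal, which forces `P = Q` (`subset_of_iInter_eq`).
-/

namespace TSharp

/-! ### The `t`-operation and maximal `t`-ideals -/

section TOperation

variable {D K : Type*} [CommRing D] [Field K] [Algebra D K]

/-- `J_v` for an integral ideal `J`, as an ideal of `D` rather than as a fractional ideal: the
elements `x` such that `y J ⊆ D` implies `x y ∈ D`. It has this meaning only for `J ≠ ⊥`. -/
def vIdeal (K : Type*) [Field K] [Algebra D K] (J : Ideal D) : Ideal D where
  carrier := {x | ∀ y : K, (∀ j ∈ J, y * algebraMap D K j ∈ (algebraMap D K).range) →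
    y * algebraMap D K x ∈ (algebraMap D K).range}
  zero_mem' y _ := by simp
  add_mem' {a b} ha hb y hy := by
    rw [map_add, mul_add]
    exact add_mem (ha y hy) (hb y hy)
  smul_mem' c x hx y hy := by
    rw [smul_eq_mul, map_mul, mul_left_comm]
    exact mul_mem ⟨c, rfl⟩ (hx y hy)

lemma le_vIdeal (J : Ideal D) : J ≤ vIdeal K J := fun x hx _ hy => hy x hx

lemma vIdeal_le_vIdeal {J J' : Ideal D} (h : J ≤ vIdeal K J') : vIdeal K J ≤ vIdeal K J' :=
  fun _ hx y hy => hx y fun _ hj => h hj y hy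

lemma vIdeal_mono {J J' : Ideal D} (h : J ≤ J') : vIdeal K J ≤ vIdeal K J' :=
  vIdeal_le_vIdeal (h.trans (le_vIdeal J'))

/-- `I_t` for an integral ideal `I`, as an ideal of `D`; the value at `⊥` is `⊥`. The supremum is a
directed union, see `mem_tIdeal`. -/
def tIdeal (K : Type*) [Field K] [Algebra D K] (I : Ideal D) : Ideal D :=
  sSup (vIdeal K '' {J | J ≠ ⊥ ∧ J.FG ∧ J ≤ I})

lemma directedOn_vIdeal (I : Ideal D) :
    DirectedOn (· ≤ ·) (vIdeal K '' {J | J ≠ ⊥ ∧ J.FG ∧ J ≤ I}) := by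
  rintro _ ⟨J, ⟨hJ, hfg, hle⟩, rfl⟩ _ ⟨J', ⟨_, hfg', hle'⟩, rfl⟩
  exact ⟨_, ⟨J ⊔ J', ⟨ne_bot_of_le_ne_bot hJ le_sup_left, Submodule.FG.sup hfg hfg',
    sup_le hle hle'⟩, rfl⟩,
    vIdeal_mono le_sup_left, vIdeal_mono le_sup_right⟩

lemma exists_ne_bot_fg_le {I : Ideal D} (hI : I ≠ ⊥) : ∃ J : Ideal D, J ≠ ⊥ ∧ J.FG ∧ J ≤ I := by
  obtain ⟨x, hx, hx0⟩ := Submodule.exists_mem_ne_zero_of_ne_bot hI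
  exact ⟨Ideal.span {x}, by simpa using hx0, Submodule.fg_span_singleton x,
    (Ideal.span_singleton_le_iff_mem I).mpr hx⟩

lemma tIdeal_mono {I I' : Ideal D} (h : I ≤ I') : tIdeal K I ≤ tIdeal K I' :=
  sSup_le_sSup (Set.image_mono fun _ hJ => ⟨hJ.1, hJ.2.1, hJ.2.2.trans h⟩)

lemma mem_tIdeal {I : Ideal D} (hI : I ≠ ⊥) {x : D} :
    x ∈ tIdeal K I ↔ ∃ J : Ideal D, J ≠ ⊥ ∧ J.FG ∧ J ≤ I ∧ x ∈ vIdeal K J := by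
  obtain ⟨J₀, h₀⟩ := exists_ne_bot_fg_le hI
  rw [tIdeal, Submodule.mem_sSup_of_directed (Set.Nonempty.image _ ⟨J₀, h₀⟩) (directedOn_vIdeal I)]
  simp [and_assoc]

lemma le_tIdeal {I : Ideal D} (hI : I ≠ ⊥) : I ≤ tIdeal K I := fun x hx => by
  obtain ⟨J, hJ, hfg, hle⟩ := exists_ne_bot_fg_le hI
  exact (mem_tIdeal hI).mpr ⟨J ⊔ Ideal.span {x}, ne_bot_of_le_ne_bot hJ le_sup_left,
    Submodule.FG.sup hfg (Submodule.fg_span_singleton x),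
    sup_le hle ((Ideal.span_singleton_le_iff_mem I).mpr hx),
    le_vIdeal _ ((Ideal.span_singleton_le_iff_mem _).mp le_sup_right)⟩

/-- A finitely generated ideal inside `I_t`, being compact, already lies in a single `J_v`; hence
the `t`-operation is idempotent. -/
lemma tIdeal_tIdeal {I : Ideal D} (hI : I ≠ ⊥) : tIdeal K (tIdeal K I) = tIdeal K I := by
  have ht := ne_bot_of_le_ne_bot hI (le_tIdeal (K := K) hI)
  refine le_antisymm (fun x hx => ?_) (le_tIdeal ht)
  obtain ⟨J, hJ, hfg, hle, hxJ⟩ := (mem_tIdeal ht).mp hx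
  obtain ⟨J₀, h₀⟩ := exists_ne_bot_fg_le hI
  obtain ⟨_, ⟨J', ⟨hJ', hfg', hle'⟩, rfl⟩, hJJ'⟩ :=
    (CompleteLattice.isCompactElement_iff_le_of_directed_sSup_le _ _).mp
      ((Submodule.fg_iff_compact J).mp hfg) _ (Set.Nonempty.image _ ⟨J₀, h₀⟩)
      (directedOn_vIdeal (K := K) I) hle
  exact (mem_tIdeal hI).mpr ⟨J', hJ', hfg', hle', vIdeal_le_vIdeal hJJ' hxJ⟩

variable [IsDomain D] [IsFractionRing D K]

lemma mem_inv_coeIdeal {J : Ideal D} (hJ : J ≠ ⊥) {y : K} :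
    y ∈ (J : FractionalIdeal D⁰ K)⁻¹ ↔
      ∀ j ∈ J, y * algebraMap D K j ∈ (algebraMap D K).range := by
  rw [FractionalIdeal.mem_inv_iff (FractionalIdeal.coeIdeal_ne_zero.mpr hJ)]
  constructor
  · intro h j hj
    obtain ⟨r, hr⟩ := (FractionalIdeal.mem_one_iff D⁰).mp
      (h _ (FractionalIdeal.mem_coeIdeal_of_mem D⁰ hj))
    exact ⟨r, hr⟩
  · intro h z hz
    obtain ⟨j, hj, rfl⟩ := (FractionalIdeal.mem_coeIdeal D⁰).mp hz
    obtain ⟨r, hr⟩ := h j hj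
    exact (FractionalIdeal.mem_one_iff D⁰).mpr ⟨r, hr⟩

lemma one_mem_inv_coeIdeal {J : Ideal D} (hJ : J ≠ ⊥) :
    (1 : K) ∈ (J : FractionalIdeal D⁰ K)⁻¹ :=
  (mem_inv_coeIdeal hJ).mpr fun j _ => ⟨j, (one_mul _).symm⟩

lemma mem_vClosure_coeIdeal {J : Ideal D} (hJ : J ≠ ⊥) {z : K} :
    z ∈ vClosure (J : FractionalIdeal D⁰ K) ↔ ∃ x ∈ vIdeal K J, algebraMap D K x = z := by
  have hne : (J : FractionalIdeal D⁰ K)⁻¹ ≠ 0 := fun h0 => by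
    have h1 := one_mem_inv_coeIdeal (K := K) hJ
    rw [h0] at h1
    exact one_ne_zero ((FractionalIdeal.mem_zero_iff D⁰).mp h1)
  rw [vClosure, FractionalIdeal.mem_inv_iff hne]
  constructor
  · intro h
    obtain ⟨x, hx⟩ := (FractionalIdeal.mem_one_iff D⁰).mp (h 1 (one_mem_inv_coeIdeal hJ))
    rw [mul_one] at hx
    refine ⟨x, fun y hy => ?_, hx⟩
    obtain ⟨r, hr⟩ := (FractionalIdeal.mem_one_iff D⁰).mp (h y ((mem_inv_coeIdeal hJ).mpr hy))
    exact ⟨r, by rw [hr, hx, mul_comm]⟩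
  · rintro ⟨x, hx, rfl⟩ y hy
    obtain ⟨r, hr⟩ := hx y ((mem_inv_coeIdeal hJ).mp hy)
    exact (FractionalIdeal.mem_one_iff D⁰).mpr ⟨r, by rw [hr, mul_comm]⟩

lemma inv_coeIdeal_eq_one_iff {J : Ideal D} :
    (J : FractionalIdeal D⁰ K)⁻¹ = 1 ↔ J ≠ ⊥ ∧ (1 : D) ∈ vIdeal K J := by
  constructor
  · intro h
    have hJ : J ≠ ⊥ := by
      rintro rfl
      rw [FractionalIdeal.coeIdeal_bot, FractionalIdeal.inv_zero'] at h
      exact zero_ne_one h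
    refine ⟨hJ, fun y hy => ?_⟩
    rw [← mem_inv_coeIdeal hJ, h] at hy
    obtain ⟨r, hr⟩ := (FractionalIdeal.mem_one_iff D⁰).mp hy
    exact ⟨r, by simp [hr]⟩
  · rintro ⟨hJ, h1⟩
    refine le_antisymm (fun y hy => ?_) (FractionalIdeal.one_le.mpr (one_mem_inv_coeIdeal hJ))
    obtain ⟨r, hr⟩ := h1 y ((mem_inv_coeIdeal hJ).mp hy)
    exact (FractionalIdeal.mem_one_iff D⁰).mpr ⟨r, by simpa using hr⟩

lemma mem_tClosure_coeIdeal {I : Ideal D} (hI : I ≠ ⊥) {z : K} :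
    z ∈ tClosure (I : FractionalIdeal D⁰ K) ↔ ∃ x ∈ tIdeal K I, algebraMap D K x = z := by
  constructor
  · rintro ⟨J, hJ, hfg, hle, hz⟩
    obtain ⟨J, rfl⟩ := FractionalIdeal.le_one_iff_exists_coeIdeal.mp
      (hle.trans FractionalIdeal.coeIdeal_le_one)
    have hJ' : J ≠ ⊥ := FractionalIdeal.coeIdeal_ne_zero.mp hJ
    obtain ⟨x, hx, rfl⟩ := (mem_vClosure_coeIdeal hJ').mp hz
    exact ⟨x, (mem_tIdeal hI).mpr ⟨J, hJ',
      (FractionalIdeal.coeIdeal_fg D⁰ (IsFractionRing.injective D K) J).mp hfg,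
      (FractionalIdeal.coeIdeal_le_coeIdeal K).mp hle, hx⟩, rfl⟩
  · rintro ⟨x, hx, rfl⟩
    obtain ⟨J, hJ, hfg, hle, hxJ⟩ := (mem_tIdeal hI).mp hx
    exact ⟨J, FractionalIdeal.coeIdeal_ne_zero.mpr hJ,
      (FractionalIdeal.coeIdeal_fg D⁰ (IsFractionRing.injective D K) J).mpr hfg,
      (FractionalIdeal.coeIdeal_le_coeIdeal K).mpr hle,
      (mem_vClosure_coeIdeal hJ).mpr ⟨x, hxJ, rfl⟩⟩

lemma isTIdeal_iff {I : Ideal D} : IsTIdeal K I ↔ I ≠ ⊥ ∧ tIdeal K I ≤ I := by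
  refine and_congr_right fun hI => ⟨fun h x hx => ?_, fun h => Set.ext fun z => ?_⟩
  · have hz := (mem_tClosure_coeIdeal hI).mpr ⟨x, hx, rfl⟩
    rw [h] at hz
    obtain ⟨x', hx', he⟩ := (FractionalIdeal.mem_coeIdeal D⁰).mp hz
    exact IsFractionRing.injective D K he ▸ hx'
  · rw [mem_tClosure_coeIdeal hI, le_antisymm h (le_tIdeal hI)]
    exact (FractionalIdeal.mem_coeIdeal D⁰).symm

lemma tClosure_eq_range_iff {I : Ideal D} (hI : I ≠ ⊥) :
    tClosure (I : FractionalIdeal D⁰ K) = Set.range (algebraMap D K) ↔ tIdeal K I = ⊤ := by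
  rw [Ideal.eq_top_iff_one]
  refine ⟨fun h => ?_, fun h => Set.ext fun z => ?_⟩
  · obtain ⟨x, hx, he⟩ := (mem_tClosure_coeIdeal hI).mp
      (h.symm.subset (Set.mem_range_self 1))
    rwa [IsFractionRing.injective D K he] at hx
  · rw [mem_tClosure_coeIdeal hI, (Ideal.eq_top_iff_one _).mpr h]
    simp

lemma IsTIdeal.one_notMem_vIdeal {I J : Ideal D} (hI : IsTIdeal K I) (htop : I ≠ ⊤) (hJ : J ≠ ⊥)
    (hfg : J.FG) (hle : J ≤ I) : (1 : D) ∉ vIdeal K J := fun h =>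
  htop ((Ideal.eq_top_iff_one I).mpr
    ((isTIdeal_iff.mp hI).2 ((mem_tIdeal hI.1).mpr ⟨J, hJ, hfg, hle, h⟩)))

/-- An ideal whose `t`-closure is proper lies in a maximal `t`-ideal: a finitely generated ideal
inside the union of a chain lies in a member of the chain, so Zorn's lemma applies. -/
lemma exists_le_tMax {I : Ideal D} (hI : I ≠ ⊥) (h : tIdeal K I ≠ ⊤) : ∃ M ∈ tMax D K, I ≤ M := by
  have ht : IsTIdeal K (tIdeal K I) :=
    isTIdeal_iff.mpr ⟨ne_bot_of_le_ne_bot hI (le_tIdeal hI), (tIdeal_tIdeal hI).le⟩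
  obtain ⟨M, hle, hM⟩ := zorn_le_nonempty₀ {I : Ideal D | IsTIdeal K I ∧ I ≠ ⊤} (by
      intro c hc hch y hy
      have hne : sSup c ≠ ⊥ := ne_bot_of_le_ne_bot (hc hy).1.1 (le_sSup hy)
      refine ⟨sSup c, ⟨isTIdeal_iff.mpr ⟨hne, fun x hx => ?_⟩, fun htop => ?_⟩,
        fun z hz => le_sSup hz⟩
      · obtain ⟨J, hJ, hfg, hle, hxJ⟩ := (mem_tIdeal hne).mp hx
        obtain ⟨L, hL, hJL⟩ := (CompleteLattice.isCompactElement_iff_le_of_directed_sSup_le _ _).mp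
          ((Submodule.fg_iff_compact J).mp hfg) c ⟨y, hy⟩ hch.directedOn hle
        exact le_sSup hL ((isTIdeal_iff.mp (hc hL).1).2
          ((mem_tIdeal (hc hL).1.1).mpr ⟨J, hJ, hfg, hJL, hxJ⟩))
      · obtain ⟨L, hL, h1⟩ := (Submodule.mem_sSup_of_directed ⟨y, hy⟩ hch.directedOn).mp
          ((Ideal.eq_top_iff_one _).mp htop)
        exact (hc hL).2 ((Ideal.eq_top_iff_one L).mpr h1)) (tIdeal K I) ⟨ht, h⟩
  exact ⟨M, hM, (le_tIdeal hI).trans hle⟩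

lemma IsTIdeal.exists_le_tMax {I : Ideal D} (hI : IsTIdeal K I) (htop : I ≠ ⊤) :
    ∃ M ∈ tMax D K, I ≤ M :=
  TSharp.exists_le_tMax hI.1 fun h => htop (top_le_iff.mp (h ▸ (isTIdeal_iff.mp hI).2))

/-- If `a b ∈ M` with `a ∉ M`, then some finitely generated `J ⊆ M + (a)` has `J_v = D`, and
`b J ⊆ M` has `b` in its `v`-closure. -/
lemma isPrime_of_mem_tMax {M : Ideal D} (hM : M ∈ tMax D K) : M.IsPrime := by
  have hM : Maximal (fun I : Ideal D => IsTIdeal K I ∧ I ≠ ⊤) M := hM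
  refine ⟨hM.prop.2, fun {a b} hab => or_iff_not_imp_left.mpr fun ha => ?_⟩
  by_cases hb : b = 0
  · exact hb ▸ M.zero_mem
  have hne : M ⊔ Ideal.span {a} ≠ ⊥ := ne_bot_of_le_ne_bot hM.prop.1.1 le_sup_left
  have htop : tIdeal K (M ⊔ Ideal.span {a}) = ⊤ := by
    by_contra h
    obtain ⟨N, hN, hle⟩ := TSharp.exists_le_tMax hne h
    have hNM : N ≤ M := hM.2 (Maximal.prop (P := fun I : Ideal D => IsTIdeal K I ∧ I ≠ ⊤) hN)
      (le_sup_left.trans hle)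
    exact ha (hNM (hle (Ideal.mem_sup_right (Ideal.mem_span_singleton_self a))))
  obtain ⟨J, hJ, hfg, hle, h1⟩ := (mem_tIdeal hne).mp ((Ideal.eq_top_iff_one _).mp htop)
  refine (isTIdeal_iff.mp hM.prop.1).2 ((mem_tIdeal hM.prop.1.1).mpr
    ⟨Ideal.span {b} * J, ?_, (Submodule.fg_span_singleton b).mul hfg, ?_, fun y hy => ?_⟩)
  · simp [hb, hJ]
  · refine (Ideal.mul_mono_right hle).trans ?_
    rw [Ideal.mul_sup, Ideal.span_singleton_mul_span_singleton]
    exact sup_le Ideal.mul_le_right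
      ((Ideal.span_singleton_le_iff_mem M).mpr (by rwa [mul_comm]))
  · have := h1 (y * algebraMap D K b) fun j hj => by
      rw [mul_assoc, ← map_mul]
      exact hy _ (Ideal.mul_mem_mul (Ideal.mem_span_singleton_self b) hj)
    simpa using this

end TOperation

/-! ### Localizations at primes, and valuation rings -/

section Localization

variable {D K : Type*} [CommRing D] [Field K] [Algebra D K]

lemma localizationAt_anti {P Q : Ideal D} (h : P ≤ Q) :
    localizationAt K Q ⊆ localizationAt K P := by
  rintro x ⟨a, s, hs, rfl⟩
  exact ⟨a, s, fun hsP => hs (h hsP), rfl⟩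

/-- `D_P` is a valuation ring of `K`, in the form: it contains `x` or `x⁻¹` for each `x ∈ K`. -/
def IsValuationAt (K : Type*) [Field K] [Algebra D K] (P : Ideal D) : Prop :=
  ∀ x : K, x ∈ localizationAt K P ∨ x⁻¹ ∈ localizationAt K P

lemma IsValuationAt.anti {P Q : Ideal D} (hQ : IsValuationAt K Q) (h : P ≤ Q) :
    IsValuationAt K P := fun x =>
  (hQ x).imp (fun hx => localizationAt_anti h hx) fun hx => localizationAt_anti h hx

variable [IsFractionRing D K]

lemma algebraMap_ne_zero_of_notMem {P : Ideal D} {s : D} (hs : s ∉ P) : algebraMap D K s ≠ 0 :=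
  fun h => hs ((IsFractionRing.to_map_eq_zero_iff.mp h) ▸ P.zero_mem)

lemma le_of_localizationAt_subset {P Q : Ideal D}
    (h : localizationAt K Q ⊆ localizationAt K P) : P ≤ Q := by
  intro d hd
  by_contra hdQ
  obtain ⟨a, s, hs, he⟩ := h ⟨1, d, hdQ, rfl⟩
  rw [map_one, div_eq_div_iff (algebraMap_ne_zero_of_notMem hdQ) (algebraMap_ne_zero_of_notMem hs),
    one_mul, ← map_mul] at he
  exact hs (IsFractionRing.injective D K he ▸ P.mul_mem_left a hd)

/-- Over a valuation ring `D_P`, one of any two elements of `D` divides the other, up to a factor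
outside `P`. -/
lemma IsValuationAt.exists_dvd {P : Ideal D} (hP : IsValuationAt K P) (a b : D) :
    ∃ u ∉ P, a ∣ u * b ∨ b ∣ u * a := by
  have key : ∀ {a b : D}, b ≠ 0 →
      algebraMap D K a / algebraMap D K b ∈ localizationAt K P → ∃ u ∉ P, b ∣ u * a := by
    rintro a b hb ⟨c, u, hu, he⟩
    have hb' : algebraMap D K b ≠ 0 := mt IsFractionRing.to_map_eq_zero_iff.mp hb
    rw [div_eq_div_iff hb' (algebraMap_ne_zero_of_notMem hu), ← map_mul, ← map_mul] at he
    exact ⟨u, hu, c, by rw [mul_comm, IsFractionRing.injective D K he, mul_comm]⟩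
  rcases eq_or_ne a 0 with rfl | ha
  · obtain ⟨c, u, hu, -⟩ | ⟨c, u, hu, -⟩ := hP 0 <;> exact ⟨u, hu, Or.inr (by simp)⟩
  rcases eq_or_ne b 0 with rfl | hb
  · obtain ⟨c, u, hu, -⟩ | ⟨c, u, hu, -⟩ := hP 0 <;> exact ⟨u, hu, Or.inl (by simp)⟩
  rcases hP (algebraMap D K a / algebraMap D K b) with h | h
  · obtain ⟨u, hu, h⟩ := key hb h
    exact ⟨u, hu, Or.inr h⟩
  · rw [inv_div] at h
    obtain ⟨u, hu, h⟩ := key ha h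
    exact ⟨u, hu, Or.inl h⟩

/-- Primes below an ideal `M` with `D_M` a valuation ring form a chain. -/
lemma IsValuationAt.le_or_le {M P Q : Ideal D} (hM : IsValuationAt K M) (hP : P.IsPrime)
    (hQ : Q.IsPrime) (hPM : P ≤ M) (hQM : Q ≤ M) : P ≤ Q ∨ Q ≤ P := by
  by_contra! h
  obtain ⟨a, ha, haQ⟩ := SetLike.not_le_iff_exists.mp h.1
  obtain ⟨b, hb, hbP⟩ := SetLike.not_le_iff_exists.mp h.2
  obtain ⟨u, hu, hd | hd⟩ := hM.exists_dvd a b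
  · exact (hP.mem_or_mem (P.mem_of_dvd hd ha)).elim (fun h => hu (hPM h)) hbP
  · exact (hQ.mem_or_mem (Q.mem_of_dvd hd hb)).elim (fun h => hu (hQM h)) haQ

/-- Over a valuation ring `D_P`, finitely generated ideals become principal. -/
lemma IsValuationAt.exists_dvd_of_fg {P : Ideal D} (hval : IsValuationAt K P) (hP : P.IsPrime)
    {J : Ideal D} (hJ : J.FG) : ∃ s ∉ P, ∃ a ∈ J, ∀ j ∈ J, a ∣ s * j := by
  induction J, hJ using Submodule.fg_induction with
  | singleton x =>
    refine ⟨1, hP.one_notMem, x, Ideal.mem_span_singleton_self x, fun j hj => ?_⟩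
    rw [one_mul]
    exact Ideal.mem_span_singleton.mp hj
  | sup J₁ J₂ _ _ h₁ h₂ =>
    obtain ⟨s₁, hs₁, a₁, ha₁, hd₁⟩ := h₁
    obtain ⟨s₂, hs₂, a₂, ha₂, hd₂⟩ := h₂
    obtain ⟨u, hu, hd⟩ := hval.exists_dvd a₁ a₂
    refine ⟨u * (s₁ * s₂), fun h => ?_, ?_⟩
    · exact (hP.mem_or_mem h).elim hu fun h => (hP.mem_or_mem h).elim hs₁ hs₂
    rcases hd with hd | hd
    · refine ⟨a₁, Ideal.mem_sup_left ha₁, fun j hj => ?_⟩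
      obtain ⟨j₁, hj₁, j₂, hj₂, rfl⟩ := Submodule.mem_sup.mp hj
      have e : u * (s₁ * s₂) * (j₁ + j₂) = u * s₂ * (s₁ * j₁) + s₁ * (u * (s₂ * j₂)) := by ring
      exact e ▸ dvd_add ((hd₁ j₁ hj₁).mul_left _)
        ((hd.trans (mul_dvd_mul_left u (hd₂ j₂ hj₂))).mul_left _)
    · refine ⟨a₂, Ideal.mem_sup_right ha₂, fun j hj => ?_⟩
      obtain ⟨j₁, hj₁, j₂, hj₂, rfl⟩ := Submodule.mem_sup.mp hj
      have e : u * (s₁ * s₂) * (j₁ + j₂) = s₂ * (u * (s₁ * j₁)) + u * s₁ * (s₂ * j₂) := by ring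
      exact e ▸ dvd_add ((hd.trans (mul_dvd_mul_left u (hd₁ j₁ hj₁))).mul_left _)
        ((hd₂ j₂ hj₂).mul_left _)

variable [IsDomain D]

/-- The ring of quotients of `D` with respect to `Φ(Λ)` is the intersection of the `D_P` with
`P ∈ Λ`: the conductor `(D :_D x)` is always a `t`-ideal. -/
lemma genQuotients_tLocSystem (Λ : Set (Ideal D)) :
    genQuotients K (tLocSystem K Λ) = ⋂ P ∈ Λ, localizationAt K P := by
  ext x
  simp only [Set.mem_iInter]
  constructor
  · rintro ⟨I, ⟨-, hI⟩, hx⟩ P hP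
    obtain ⟨a, ha, haP⟩ := SetLike.not_le_iff_exists.mp (hI P hP)
    obtain ⟨r, hr⟩ := hx a ha
    exact ⟨r, a, haP, by rw [← hr, mul_div_cancel_right₀ _ (algebraMap_ne_zero_of_notMem haP)]⟩
  · intro hx
    let I : Ideal D :=
      { carrier := {d | x * algebraMap D K d ∈ (algebraMap D K).range}
        zero_mem' := by simp
        add_mem' := fun {a b} ha hb => by
          simp only [Set.mem_ofPred_eq, map_add, mul_add]
          exact add_mem ha hb
        smul_mem' := fun c d hd => by
          simp only [Set.mem_ofPred_eq, smul_eq_mul, map_mul, mul_left_comm x]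
          exact mul_mem ⟨c, rfl⟩ hd }
    have hI : I ≠ ⊥ := fun h0 => by
      obtain ⟨a, b, hb, rfl⟩ := IsFractionRing.div_surjective (A := D) x
      refine nonZeroDivisors.ne_zero hb ((Submodule.eq_bot_iff I).mp h0 b ⟨a, ?_⟩)
      rw [div_mul_cancel₀]
      exact IsFractionRing.to_map_ne_zero_of_mem_nonZeroDivisors hb
    refine ⟨I, ⟨isTIdeal_iff.mpr ⟨hI, fun z hz => ?_⟩, fun P hP hle => ?_⟩, ?_⟩
    · obtain ⟨J, -, -, hle, hzJ⟩ := (mem_tIdeal hI).mp hz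
      exact hzJ x fun j hj => hle hj
    · obtain ⟨a, s, hs, rfl⟩ := hx P hP
      exact hs (hle ⟨a, (div_mul_cancel₀ _ (algebraMap_ne_zero_of_notMem hs)).symm⟩)
    · rintro a ⟨r, hr⟩
      exact ⟨r, hr.symm⟩

lemma IsPVMD.isValuationAt (hD : IsPVMD D K) {M : Ideal D} (hM : M ∈ tMax D K) :
    IsValuationAt K M := by
  obtain ⟨V, hV⟩ := hD M hM
  intro x
  rw [← hV]
  exact V.mem_or_inv_mem x

lemma IsPVMD.isValuationAt_of_isTPrime (hD : IsPVMD D K) {P : Ideal D} (hP : IsTPrime K P) :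
    IsValuationAt K P := by
  obtain ⟨M, hM, hle⟩ := hP.2.exists_le_tMax hP.1.ne_top
  exact (hD.isValuationAt hM).anti hle

/-- If `D_P` is a valuation ring, a finitely generated `J ⊆ P` satisfies `s J ⊆ a D` with `a ∈ J`
and `s ∉ P`, so that `s / a ∈ J⁻¹` and `s J_v ⊆ a D ⊆ P`. -/
lemma IsValuationAt.isTIdeal {P : Ideal D} (hval : IsValuationAt K P) (hP : P.IsPrime)
    (hne : P ≠ ⊥) : IsTIdeal K P := by
  refine isTIdeal_iff.mpr ⟨hne, fun x hx => ?_⟩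
  obtain ⟨J, hJ, hfg, hle, hxJ⟩ := (mem_tIdeal hne).mp hx
  obtain ⟨s, hs, a, ha, hd⟩ := hval.exists_dvd_of_fg hP hfg
  have ha0 : a ≠ 0 := by
    rintro rfl
    refine hJ ((Submodule.eq_bot_iff J).mpr fun j hj => ?_)
    exact (mul_eq_zero.mp (zero_dvd_iff.mp (hd j hj))).resolve_left
      fun h => hs (h ▸ P.zero_mem)
  have ha' : algebraMap D K a ≠ 0 := mt IsFractionRing.to_map_eq_zero_iff.mp ha0
  obtain ⟨r, hr⟩ := hxJ (algebraMap D K s / algebraMap D K a) fun j hj => by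
    obtain ⟨c, hc⟩ := hd j hj
    exact ⟨c, by rw [div_mul_eq_mul_div, ← map_mul, hc, map_mul, mul_div_cancel_left₀ _ ha']⟩
  rw [div_mul_eq_mul_div, eq_div_iff ha', ← map_mul, ← map_mul] at hr
  have hmem : s * x ∈ P := IsFractionRing.injective D K hr ▸ P.mul_mem_left r (hle ha)
  exact (hP.mem_or_mem hmem).resolve_left hs

end Localization

/-! ### Maximal `t`-ideals of `t`-linked overrings -/

section Overring

variable {R K : Type*} [CommRing R] [Field K] [Algebra R K]

lemma localizationAt_comap_subset (T : Subalgebra R K) (N : Ideal T) :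
    localizationAt K (N.comap (algebraMap R T)) ⊆ localizationAt K N := by
  rintro _ ⟨a, s, hs, rfl⟩
  exact ⟨algebraMap R T a, algebraMap R T s, hs, rfl⟩

variable [IsFractionRing R K]

/-- `R_P` for a prime ideal `P`, as an overring of `R`. -/
def localizationSubalgebra (K : Type*) [Field K] [Algebra R K] [IsFractionRing R K]
    (P : Ideal R) (hP : P.IsPrime) : Subalgebra R K where
  carrier := localizationAt K P
  mul_mem' := by
    rintro _ _ ⟨a, s, hs, rfl⟩ ⟨b, t, ht, rfl⟩
    exact ⟨a * b, s * t, fun h => (hP.mem_or_mem h).elim hs ht, by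
      rw [map_mul, map_mul, div_mul_div_comm]⟩
  add_mem' := by
    rintro _ _ ⟨a, s, hs, rfl⟩ ⟨b, t, ht, rfl⟩
    exact ⟨a * t + s * b, s * t, fun h => (hP.mem_or_mem h).elim hs ht, by
      rw [div_add_div _ _ (algebraMap_ne_zero_of_notMem hs) (algebraMap_ne_zero_of_notMem ht),
        map_add, map_mul, map_mul, map_mul]⟩
  algebraMap_mem' r := ⟨r, 1, hP.one_notMem, by simp⟩

lemma mem_localizationSubalgebra {P : Ideal R} {hP : P.IsPrime} {x : K} :
    x ∈ localizationSubalgebra K P hP ↔ x ∈ localizationAt K P := Iff.rfl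

/-- The contraction `P R_P ∩ T` to an overring `T ⊆ R_P`, where `P R_P` consists of the fractions
`a / s` with `a ∈ P` and `s ∉ P`. -/
def centerIdeal {P : Ideal R} (hP : P.IsPrime) (T : Subalgebra R K)
    (hT : (T : Set K) ⊆ localizationAt K P) : Ideal T where
  carrier := {t | ∃ a ∈ P, ∃ s ∉ P, (t : K) = algebraMap R K a / algebraMap R K s}
  zero_mem' := ⟨0, P.zero_mem, 1, hP.one_notMem, by simp⟩
  add_mem' := by
    rintro t u ⟨a, ha, s, hs, ht⟩ ⟨b, hb, s', hs', hu⟩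
    refine ⟨a * s' + s * b, P.add_mem (P.mul_mem_right _ ha) (P.mul_mem_left _ hb), s * s',
      fun h => (hP.mem_or_mem h).elim hs hs', ?_⟩
    rw [Subalgebra.coe_add, ht, hu, div_add_div _ _ (algebraMap_ne_zero_of_notMem hs)
      (algebraMap_ne_zero_of_notMem hs'), map_add, map_mul, map_mul, map_mul]
  smul_mem' := by
    rintro c t ⟨a, ha, s, hs, ht⟩
    obtain ⟨b, s', hs', hc⟩ := hT c.2
    refine ⟨b * a, P.mul_mem_left _ ha, s' * s, fun h => (hP.mem_or_mem h).elim hs' hs, ?_⟩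
    rw [smul_eq_mul, Subalgebra.coe_mul, ht, hc, map_mul, map_mul, div_mul_div_comm]

lemma notMem_centerIdeal_iff {P : Ideal R} {hP : P.IsPrime} {T : Subalgebra R K}
    {hT : (T : Set K) ⊆ localizationAt K P} {t : T} :
    t ∉ centerIdeal hP T hT ↔
      ∃ a ∉ P, ∃ s ∉ P, (t : K) = algebraMap R K a / algebraMap R K s := by
  constructor
  · intro h
    obtain ⟨a, s, hs, ht⟩ := hT t.2
    exact ⟨a, fun ha => h ⟨a, ha, s, hs, ht⟩, s, hs, ht⟩
  · rintro ⟨a, ha, s, hs, ht⟩ ⟨b, hb, s', hs', ht'⟩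
    rw [ht, div_eq_div_iff (algebraMap_ne_zero_of_notMem hs) (algebraMap_ne_zero_of_notMem hs'),
      ← map_mul, ← map_mul] at ht'
    have hmem : a * s' ∈ P := IsFractionRing.injective R K ht' ▸ P.mul_mem_right s hb
    exact (hP.mem_or_mem hmem).elim ha hs'

lemma isPrime_centerIdeal {P : Ideal R} (hP : P.IsPrime) (T : Subalgebra R K)
    (hT : (T : Set K) ⊆ localizationAt K P) : (centerIdeal hP T hT).IsPrime := by
  refine ⟨fun h => ?_, fun {t u} htu => ?_⟩
  · refine notMem_centerIdeal_iff.mpr ⟨1, hP.one_notMem, 1, hP.one_notMem, ?_⟩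
      ((Ideal.eq_top_iff_one _).mp h)
    simp
  · by_contra! h
    obtain ⟨a, ha, s, hs, ht⟩ := notMem_centerIdeal_iff.mp h.1
    obtain ⟨b, hb, s', hs', hu⟩ := notMem_centerIdeal_iff.mp h.2
    refine notMem_centerIdeal_iff.mpr ⟨a * b, fun h => (hP.mem_or_mem h).elim ha hb,
      s * s', fun h => (hP.mem_or_mem h).elim hs hs', ?_⟩ htu
    rw [Subalgebra.coe_mul, ht, hu, map_mul, map_mul, div_mul_div_comm]

lemma comap_centerIdeal {P : Ideal R} (hP : P.IsPrime) (T : Subalgebra R K)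
    (hT : (T : Set K) ⊆ localizationAt K P) :
    (centerIdeal hP T hT).comap (algebraMap R T) = P := by
  ext r
  refine ⟨fun h => ?_, fun h => ⟨r, h, 1, hP.one_notMem, by simp⟩⟩
  by_contra hr
  exact notMem_centerIdeal_iff.mpr ⟨r, hr, 1, hP.one_notMem, by simp⟩ (Ideal.mem_comap.mp h)

lemma localizationAt_centerIdeal {P : Ideal R} (hP : P.IsPrime) (T : Subalgebra R K)
    (hT : (T : Set K) ⊆ localizationAt K P) :
    localizationAt K (centerIdeal hP T hT) = localizationAt K P := by
  ext x
  constructor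
  · rintro ⟨t, u, hu, rfl⟩
    obtain ⟨b, w, hw, ht⟩ := hT t.2
    obtain ⟨a, ha, s, hs, hu⟩ := notMem_centerIdeal_iff.mp hu
    refine ⟨b * s, w * a, fun h => (hP.mem_or_mem h).elim hw ha, ?_⟩
    rw [map_mul, map_mul, ← div_div_div_eq, ← ht, ← hu]
    rfl
  · rintro ⟨a, s, hs, rfl⟩
    exact ⟨algebraMap R T a, algebraMap R T s, notMem_centerIdeal_iff.mpr
      ⟨s, hs, 1, hP.one_notMem, by simp⟩, rfl⟩

variable [IsDomain R]

/-- The `t`-linked overrings include all intersections of localizations at prime `t`-ideals: a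
finitely generated `I` with `I⁻¹ = R` is contained in no prime `t`-ideal `P`, so `I R_P = R_P`. -/
lemma isTLinked_of_eq_iInter {Λ : Set (Ideal R)} (hΛ : ∀ P ∈ Λ, IsTPrime K P)
    {T : Subalgebra R K} (hT : (T : Set K) = ⋂ P ∈ Λ, localizationAt K P) : IsTLinked T := by
  intro I hfg hI
  obtain ⟨hne, h1⟩ := inv_coeIdeal_eq_one_iff.mp hI
  refine inv_coeIdeal_eq_one_iff.mpr ⟨?_, fun y hy => ?_⟩
  · rwa [Ne, Ideal.map_eq_bot_iff_of_injective (FaithfulSMul.algebraMap_injective R T)]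
  rw [map_one, mul_one]
  suffices h : y ∈ (T : Set K) from ⟨⟨y, h⟩, rfl⟩
  rw [hT]
  refine Set.mem_iInter₂.mpr fun P hP => ?_
  have hIP : ¬ I ≤ P := fun hle => (hΛ P hP).2.one_notMem_vIdeal (hΛ P hP).1.ne_top hne hfg hle h1
  obtain ⟨s, hs, hsP⟩ := SetLike.not_le_iff_exists.mp hIP
  obtain ⟨t, ht⟩ := hy _ (Ideal.mem_map_of_mem (algebraMap R T) hs)
  have hmem : y * algebraMap R K s ∈ localizationAt K P := by
    have h : y * algebraMap R K s ∈ (T : Set K) := by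
      rw [show algebraMap R K s = algebraMap T K (algebraMap R T s) from rfl, ← ht]
      exact t.2
    rw [hT] at h
    exact Set.mem_iInter₂.mp h P hP
  have := mul_mem (mem_localizationSubalgebra (hP := (hΛ P hP).1).mpr hmem)
    (mem_localizationSubalgebra.mpr ⟨1, s, hsP, rfl⟩)
  rwa [map_one, mul_assoc, mul_one_div_cancel (algebraMap_ne_zero_of_notMem hsP), mul_one] at this

/-- A prime `t`-ideal `P` of a PVMD with `T ⊆ R_P` lies under a prime `t`-ideal of `T` with the
same localization, hence under a maximal `t`-ideal of `T`. -/
lemma exists_tMax_of_subset_localizationAt (hR : IsPVMD R K) {P : Ideal R} (hP : IsTPrime K P)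
    {T : Subalgebra R K} (hT : (T : Set K) ⊆ localizationAt K P) :
    ∃ N ∈ tMax T K, P ≤ N.comap (algebraMap R T) ∧ localizationAt K N ⊆ localizationAt K P := by
  have hloc := localizationAt_centerIdeal hP.1 T hT
  have hcomap := comap_centerIdeal hP.1 T hT
  have hprime := isPrime_centerIdeal hP.1 T hT
  have hval : IsValuationAt K (centerIdeal hP.1 T hT) := fun x => by
    rw [hloc]
    exact hR.isValuationAt_of_isTPrime hP x
  have hne : centerIdeal hP.1 T hT ≠ ⊥ := fun h => by
    rw [h, Ideal.comap_bot_of_injective _ (FaithfulSMul.algebraMap_injective R T)] at hcomap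
    exact hP.2.1 hcomap.symm
  obtain ⟨N, hN, hle⟩ := (hval.isTIdeal hprime hne).exists_le_tMax hprime.ne_top
  exact ⟨N, hN, hcomap.symm.le.trans (Ideal.comap_mono hle), hloc ▸ localizationAt_anti hle⟩

/-- For a maximal `t`-ideal `N` of a `t`-linked overring of `R`, `P = N ∩ R` lies in a maximal
`t`-ideal `M` of `R`: otherwise a finitely generated `J ⊆ P` has `J⁻¹ = R`, and then
`(J T)⁻¹ = T` although `J T ⊆ N`. -/
lemma exists_tMax_comap_le {T : Subalgebra R K} (hT : IsTLinked T) {N : Ideal T}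
    (hN : N ∈ tMax T K) :
    N.comap (algebraMap R T) ≠ ⊥ ∧ ∃ M ∈ tMax R K, N.comap (algebraMap R T) ≤ M := by
  have hN' : Maximal (fun I : Ideal T => IsTIdeal K I ∧ I ≠ ⊤) N := hN
  have hne : N.comap (algebraMap R T) ≠ ⊥ := fun h => by
    obtain ⟨t, ht, ht0⟩ := Submodule.exists_mem_ne_zero_of_ne_bot hN'.prop.1.1
    obtain ⟨a, b, hb, he⟩ := IsFractionRing.div_surjective (A := R) (t : K)
    have hb' := IsFractionRing.to_map_ne_zero_of_mem_nonZeroDivisors (K := K) hb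
    have hta : algebraMap R T a = t * algebraMap R T b :=
      Subtype.ext ((div_eq_iff hb').mp he)
    have ha : a ∈ N.comap (algebraMap R T) := by
      rw [Ideal.mem_comap, hta]
      exact N.mul_mem_right _ ht
    rw [h, Ideal.mem_bot] at ha
    rw [ha, map_zero, zero_div] at he
    exact ht0 (Subtype.ext he.symm)
  refine ⟨hne, exists_le_tMax hne fun htop => ?_⟩
  obtain ⟨J, hJ, hfg, hle, h1⟩ := (mem_tIdeal hne).mp ((Ideal.eq_top_iff_one _).mp htop)
  obtain ⟨hJT, h1T⟩ := inv_coeIdeal_eq_one_iff.mp (hT J hfg (inv_coeIdeal_eq_one_iff.mpr ⟨hJ, h1⟩))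
  exact hN'.prop.1.one_notMem_vIdeal hN'.prop.2 hJT (hfg.map _) (Ideal.map_le_iff_le_comap.mpr hle)
    h1T

/-- For a maximal `t`-ideal `N` of a `t`-linked overring `T` of a PVMD `R`, the contraction
`P = N ∩ R` is a prime `t`-ideal and `T_N = R_P`: if `x ∈ T_N` were not in the valuation ring `R_P`,
then `x⁻¹` would lie in `P R_P ⊆ N T_N`. -/
lemma isTPrime_comap_and_localizationAt (hR : IsPVMD R K) {T : Subalgebra R K}
    (hT : IsTLinked T) {N : Ideal T} (hN : N ∈ tMax T K) :
    IsTPrime K (N.comap (algebraMap R T)) ∧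
      localizationAt K (N.comap (algebraMap R T)) = localizationAt K N := by
  have hNp := isPrime_of_mem_tMax hN
  have hP : (N.comap (algebraMap R T)).IsPrime := hNp.comap _
  obtain ⟨hne, M, hM, hle⟩ := exists_tMax_comap_le hT hN
  have hval := (hR.isValuationAt hM).anti hle
  refine ⟨⟨hP, hval.isTIdeal hP hne⟩, (localizationAt_comap_subset T N).antisymm ?_⟩
  rintro _ ⟨t, u, hu, rfl⟩
  have hu' := algebraMap_ne_zero_of_notMem (K := K) hu
  by_contra hx
  obtain ⟨a, s, hs, he⟩ := (hval _).resolve_left hx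
  rcases eq_or_ne t 0 with rfl | ht
  · exact hx ⟨0, 1, hP.one_notMem, by simp⟩
  by_cases ha : a ∈ N.comap (algebraMap R T)
  · have ht' : algebraMap T K t ≠ 0 := mt IsFractionRing.to_map_eq_zero_iff.mp ht
    have hs' : algebraMap R K s ≠ 0 := algebraMap_ne_zero_of_notMem hs
    rw [inv_div, div_eq_div_iff ht' hs'] at he
    have hmem : u * algebraMap R T s ∈ N :=
      (Subtype.ext he : u * algebraMap R T s = algebraMap R T a * t) ▸ N.mul_mem_right t ha
    exact (hNp.mem_or_mem hmem).elim hu hs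
  · exact hx ⟨s, a, ha, by rw [← inv_inj, he, inv_div]⟩

lemma eq_of_comap_le_comap (hR : IsPVMD R K) {T : Subalgebra R K} (hT : IsTLinked T)
    {N₁ N₂ : Ideal T} (h₁ : N₁ ∈ tMax T K) (h₂ : N₂ ∈ tMax T K)
    (hle : N₁.comap (algebraMap R T) ≤ N₂.comap (algebraMap R T)) : N₁ = N₂ := by
  have hN : N₁ ≤ N₂ := le_of_localizationAt_subset (K := K) (by
    rw [← (isTPrime_comap_and_localizationAt hR hT h₁).2,
      ← (isTPrime_comap_and_localizationAt hR hT h₂).2]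
    exact localizationAt_anti hle)
  have h₁' : Maximal (fun I : Ideal T => IsTIdeal K I ∧ I ≠ ⊤) N₁ := h₁
  have h₂' : Maximal (fun I : Ideal T => IsTIdeal K I ∧ I ≠ ⊤) N₂ := h₂
  exact h₁'.eq_of_le h₂'.prop hN

end Overring

/-! ### The `t#`-property of `t`-linked overrings -/

section TSharpOverring

variable {R K : Type*} [CommRing R] [IsDomain R] [Field K] [Algebra R K] [IsFractionRing R K]

/-- Contraction identifies the maximal `t`-ideals of `T` with pairwise `t`-comaximal prime
`t`-ideals of `R`, preserving localizations. -/
lemma IsTSharpP.isTSharp (hR : IsPVMD R K) (hP : IsTSharpP R K) {T : Subalgebra R K}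
    (hT : IsTLinked T) : IsTSharp T K := by
  intro M₁ M₂ h₁ h₂ hne heq
  have key : ∀ M ⊆ tMax T K,
      genQuotients K (tLocSystem K (Ideal.comap (algebraMap R T) '' M)) =
        ⋂ N ∈ M, localizationAt K N := fun M hM => by
    rw [genQuotients_tLocSystem, Set.biInter_image]
    exact Set.iInter₂_congr fun N hN => (isTPrime_comap_and_localizationAt hR hT (hM hN)).2
  have hinj : Set.InjOn (Ideal.comap (algebraMap R T)) (tMax T K) :=
    fun N₁ hN₁ N₂ hN₂ h => eq_of_comap_le_comap hR hT hN₁ hN₂ h.le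
  refine hP (Ideal.comap (algebraMap R T) '' M₁) (Ideal.comap (algebraMap R T) '' M₂) ?_ ?_
    (fun h => hne ((hinj.image_eq_image_iff h₁ h₂).mp h)) ?_ (by rw [key M₁ h₁, key M₂ h₂, heq])
  · rintro _ ⟨N, hN, rfl⟩
    exact (isTPrime_comap_and_localizationAt hR hT (h₁ hN)).1
  · rintro _ ⟨N, hN, rfl⟩
    exact (isTPrime_comap_and_localizationAt hR hT (h₂ hN)).1
  · rintro _ ⟨N₁, hN₁, rfl⟩ _ ⟨N₂, hN₂, rfl⟩ hN
    have hp₁ := (isTPrime_comap_and_localizationAt hR hT (h₁ hN₁)).1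
    have hp₂ := (isTPrime_comap_and_localizationAt hR hT (h₂ hN₂)).1
    rw [Submodule.add_eq_sup]
    have hbot := ne_bot_of_le_ne_bot hp₁.2.1
      (le_sup_left (b := N₂.comap (algebraMap R T)))
    rw [tClosure_eq_range_iff hbot]
    by_contra htop
    -- In a common maximal `t`-ideal the two contractions would be comparable, hence equal.
    obtain ⟨M, hM, hle⟩ := exists_le_tMax hbot htop
    rcases (hR.isValuationAt hM).le_or_le hp₁.1 hp₂.1 (le_sup_left.trans hle)
      (le_sup_right.trans hle) with h | h
    · exact hN (by rw [eq_of_comap_le_comap hR hT (h₁ hN₁) (h₂ hN₂) h])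
    · exact hN (by rw [eq_of_comap_le_comap hR hT (h₂ hN₂) (h₁ hN₁) h])

/-- With `T = ⋂_{P ∈ Λ₁} R_P = ⋂_{Q ∈ Λ₂} R_Q` and `P ∈ Λ₁`, take a maximal `t`-ideal `N` of `T`
over `P`. As `T` is a `t#`-domain, `N` cannot be omitted from the maximal `t`-ideals over the
members of `Λ₂`: it also lies over some `Q ∈ Λ₂`, and `P + Q ⊆ N ∩ R`. -/
lemma subset_of_iInter_eq (hR : IsPVMD R K)
    (h : ∀ T : Subalgebra R K, IsTLinked T → IsTSharp T K) {Λ₁ Λ₂ : Set (Ideal R)}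
    (h₁ : ∀ P ∈ Λ₁, IsTPrime K P) (h₂ : ∀ Q ∈ Λ₂, IsTPrime K Q)
    (hcomax : ∀ P ∈ Λ₁, ∀ Q ∈ Λ₂, P ≠ Q → tIdeal K (P ⊔ Q) = ⊤)
    (heq : ⋂ P ∈ Λ₁, localizationAt K P = ⋂ Q ∈ Λ₂, localizationAt K Q) : Λ₁ ⊆ Λ₂ := by
  intro P hP
  by_contra hPΛ
  let T : Subalgebra R K := ⨅ P : Λ₁, localizationSubalgebra K P.1 (h₁ P.1 P.2).1
  have hT₁ : (T : Set K) = ⋂ P ∈ Λ₁, localizationAt K P := by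
    rw [Set.biInter_eq_iInter, Algebra.coe_iInf]
    rfl
  have hTsub : ∀ Q ∈ Λ₂, (T : Set K) ⊆ localizationAt K Q := fun Q hQ => by
    rw [hT₁, heq]
    exact Set.biInter_subset_of_mem hQ
  have hlinked := isTLinked_of_eq_iInter h₁ hT₁
  obtain ⟨N, hN, hPN, -⟩ := exists_tMax_of_subset_localizationAt hR (h₁ P hP)
    (hT₁ ▸ Set.biInter_subset_of_mem hP : (T : Set K) ⊆ localizationAt K P)
  have hne : tMax T K \ {N} ≠ tMax T K := fun he => (he.symm.subset hN).2 rfl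
  obtain ⟨x, hx, hxN⟩ : ∃ x ∈ ⋂ N' ∈ tMax T K \ {N}, localizationAt K N',
      x ∉ ⋂ N' ∈ tMax T K, localizationAt K N' := by
    by_contra! hsub
    exact h T hlinked _ _ Set.sdiff_subset subset_rfl hne
      (Set.Subset.antisymm hsub (Set.biInter_subset_biInter_left Set.sdiff_subset))
  obtain ⟨Q, hQ, hxQ⟩ : ∃ Q ∈ Λ₂, x ∉ localizationAt K Q := by
    by_contra! hall
    have hxT : x ∈ (T : Set K) := by
      rw [hT₁, heq]
      exact Set.mem_iInter₂.mpr hall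
    exact hxN (Set.mem_iInter₂.mpr fun N' hN' =>
      ⟨⟨x, hxT⟩, 1, (isPrime_of_mem_tMax hN').one_notMem, by rw [map_one, div_one]; rfl⟩)
  -- The maximal `t`-ideal `N'` over `Q` has `T_N' ⊆ R_Q`, hence `x ∉ T_N'`, and `N` is the only
  -- maximal `t`-ideal at which `x` is missing.
  obtain ⟨N', hN', hQN, hloc⟩ := exists_tMax_of_subset_localizationAt hR (h₂ Q hQ) (hTsub Q hQ)
  have hNN : N' = N := by
    by_contra hNN
    exact hxQ (hloc (Set.mem_iInter₂.mp hx N' ⟨hN', hNN⟩))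
  subst hNN
  have htop := hcomax P hP Q hQ (fun hPQ => hPΛ (hPQ ▸ hQ))
  obtain ⟨hprime, htideal⟩ := (isTPrime_comap_and_localizationAt hR hlinked hN).1
  exact hprime.ne_top (top_le_iff.mp
    (htop ▸ (tIdeal_mono (sup_le hPN hQN)).trans (isTIdeal_iff.mp htideal).2))

end TSharpOverring

end TSharp

/-- Overrings of `R` are the rings `T` with `R ⊆ T ⊆ K`, i.e. the `R`-subalgebras of `K`. -/
theorem proposition2p9 {R K : Type*} [CommRing R] [IsDomain R] [Field K] [Algebra R K]
    [IsFractionRing R K] (hR : TSharp.IsPVMD R K) :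
    TSharp.IsTSharpP R K ↔
      ∀ T : Subalgebra R K, TSharp.IsTLinked T → TSharp.IsTSharp T K := by
  refine ⟨fun hP T hT => hP.isTSharp hR hT, fun h Λ₁ Λ₂ h₁ h₂ hne hcomax heq => ?_⟩
  rw [TSharp.genQuotients_tLocSystem, TSharp.genQuotients_tLocSystem] at heq
  have hcomax' : ∀ P ∈ Λ₁, ∀ Q ∈ Λ₂, P ≠ Q → TSharp.tIdeal K (P ⊔ Q) = ⊤ :=
    fun P hP Q hQ hPQ => (TSharp.tClosure_eq_range_iff
      (ne_bot_of_le_ne_bot (h₁ P hP).2.1 le_sup_left)).mp (hcomax P hP Q hQ hPQ)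
  refine hne ((TSharp.subset_of_iInter_eq hR h h₁ h₂ hcomax' heq).antisymm
    (TSharp.subset_of_iInter_eq hR h h₂ h₁ (fun Q hQ P hP hQP => ?_) heq.symm))
  rw [sup_comm]
  exact hcomax' P hP Q hQ hQP.symm
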